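/- Let $X$ be a finite simple graph that is (i) a permutation graph, i.e. the intersection graph of a family of linear functions $f_v(t)=a_vt+b_v$ ($v\in V(X)$) on the interval $[0,1]$: two distinct vertices $u,v$ are adjacent if and only if $f_u(t)=f_v(t)$ for some $t\in[0,1]$; and (ii) prime, i.e. all its modules are trivial, where a module is a non-empty set $M\subseteq V(X)$ such that every vertex outside $M$ is adjacent either to all vertices of $M$ or to none of them, and a module $M$ is trivial if $M=V(X)$ or $|M|=1$. Then the automorphism group $\mathrm{Aut}(X)$ is isomorphic to a subgroup of $\mathbb{Z}_2^2=\mathbb{Z}_2\times\mathbb{Z}_2$. -/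

import Mathlib

namespace SimpleGraph

variable {V : Type*}

/-- A module of a graph: a non-empty set `M` of vertices such that every vertex outside `M` is
adjacent either to all vertices of `M` or to none of them. -/
def IsGraphModule (X : SimpleGraph V) (M : Set V) : Prop :=
  M.Nonempty ∧ ∀ x, x ∉ M → (∀ m ∈ M, X.Adj x m) ∨ (∀ m ∈ M, ¬ X.Adj x m)

/-- A graph is prime if it has only trivial modules: the whole vertex set and the singletons. -/
def IsPrimeGraph (X : SimpleGraph V) : Prop :=
  ∀ M : Set V, X.IsGraphModule M → M = Set.univ ∨ ∃ v, M = {v}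

/-- A permutation graph: the intersection graph of a family of linear functions
`t ↦ a v * t + b v` on the interval `[0, 1]`, that is, of a family of straight segments joining
two parallel lines. -/
def IsPermutationGraph (X : SimpleGraph V) : Prop :=
  ∃ a b : V → ℝ, ∀ u v : V,
    X.Adj u v ↔ u ≠ v ∧ ∃ t ∈ Set.Icc (0 : ℝ) 1, a u * t + b u = a v * t + b v

end SimpleGraph

/-! By Gallai, a prime graph has at most one transitive orientation up to reversal: in a prime graph
every forcing class spans all vertices, so a colouring of the edges that respects forcing is
constant (`forall_or_forall_not`), and "two orientations agree here" is such a colouring. The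
segments orient both the graph and its complement, which is again prime, and the two orientations
together form a linear order. An automorphism preserves or reverses each orientation, which gives
two signs in `ZMod 2`. If both are trivial it preserves a finite linear order, so it is the
identity; hence the pair of signs is injective. -/

namespace SimpleGraph

variable {V : Type*}

/-- The forcing class of the edge `b c`: the edges reached from it by passing from `u v` to `u z`
where `v` and `z` are not adjacent. -/
inductive ForcingClass (X : SimpleGraph V) (b c : V) : V → V → Prop
  | base : ForcingClass X b c b c
  | swap {u v : V} : ForcingClass X b c u v → ForcingClass X b c v u
  | step {u v z : V} : ForcingClass X b c u v → X.Adj u z → ¬ X.Adj v z → ForcingClass X b c u z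

namespace ForcingClass

variable {X : SimpleGraph V} {b c : V}

theorem adj (hbc : X.Adj b c) {u v : V} (h : X.ForcingClass b c u v) : X.Adj u v := by
  induction h with
  | base => exact hbc
  | swap _ ih => exact ih.symm
  | step _ h _ _ => exact h

/-- A vertex that lies on no edge of a forcing class does not separate the ends of its edges. -/
theorem adj_iff_adj {x : V} (hx : ¬ ∃ y, X.ForcingClass b c x y) {u v : V}
    (h : X.ForcingClass b c u v) : X.Adj x u ↔ X.Adj x v := by
  constructor
  · intro hu
    by_contra hv
    exact hx ⟨u, (h.step hu.symm fun h' => hv h'.symm).swap⟩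
  · intro hv
    by_contra hu
    exact hx ⟨v, (h.swap.step hv.symm fun h' => hu h'.symm).swap⟩

theorem adj_iff_adj_base {x : V} (hx : ¬ ∃ y, X.ForcingClass b c x y) {u v : V}
    (h : X.ForcingClass b c u v) : X.Adj x u ↔ X.Adj x b := by
  -- Both ends are tracked because `swap` exchanges them.
  have key : (X.Adj x u ↔ X.Adj x b) ∧ (X.Adj x v ↔ X.Adj x b) := by
    induction h with
    | base => exact ⟨Iff.rfl, (adj_iff_adj hx base).symm⟩
    | swap _ ih => exact ih.symm
    | step h h₁ h₂ ih => exact ⟨ih.1, (adj_iff_adj hx (h.step h₁ h₂)).symm.trans ih.1⟩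
  exact key.1

theorem isGraphModule_span : X.IsGraphModule {x | ∃ y, X.ForcingClass b c x y} := by
  refine ⟨⟨b, c, base⟩, fun x hx => ?_⟩
  by_cases hb : X.Adj x b
  · exact Or.inl fun m ⟨_, hm⟩ => (adj_iff_adj_base hx hm).2 hb
  · exact Or.inr fun m ⟨_, hm⟩ h => hb ((adj_iff_adj_base hx hm).1 h)

/-- In a prime graph every forcing class covers all vertices. -/
theorem exists_of_isPrimeGraph (hX : X.IsPrimeGraph) (hbc : X.Adj b c) (x : V) :
    ∃ y, X.ForcingClass b c x y := by
  rcases hX _ (isGraphModule_span (X := X) (b := b) (c := c)) with h | ⟨v, h⟩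
  · exact h.ge (Set.mem_univ x)
  · have hb : b ∈ ({v} : Set V) := h ▸ ⟨c, base⟩
    have hc : c ∈ ({v} : Set V) := h ▸ ⟨b, base.swap⟩
    exact absurd (hb.trans hc.symm) hbc.ne

end ForcingClass

/-- A colouring of the edges by `True` and `False` that is constant on forcing classes. -/
structure IsForcingInvariant (X : SimpleGraph V) (C : V → V → Prop) : Prop where
  symm : ∀ {u v}, X.Adj u v → (C u v ↔ C v u)
  step : ∀ {u v z}, X.Adj u v → X.Adj u z → ¬ X.Adj v z → (C u v ↔ C u z)

namespace IsForcingInvariant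

variable {X : SimpleGraph V} {C : V → V → Prop}

theorem not (hC : X.IsForcingInvariant C) : X.IsForcingInvariant fun u v => ¬ C u v :=
  ⟨fun h => not_congr (hC.symm h), fun h₁ h₂ h₃ => not_congr (hC.step h₁ h₂ h₃)⟩

/-- Along the forcing class of `b c`, the vertex `a` stays joined to both ends by edges of the other
colour. The class reaches `a` itself, which would give a loop. -/
theorem not_triangle (hC : X.IsForcingInvariant C) (hX : X.IsPrimeGraph) {a b c : V}
    (hbc : X.Adj b c) (hab : X.Adj a b) (hac : X.Adj a c)
    (cbc : C b c) (cab : ¬ C a b) (cac : ¬ C a c) : False := by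
  have key : ∀ {u v}, X.ForcingClass b c u v →
      C u v ∧ (X.Adj a u ∧ ¬ C a u) ∧ (X.Adj a v ∧ ¬ C a v) := by
    intro u v h
    induction h with
    | base => exact ⟨cbc, ⟨hab, cab⟩, hac, cac⟩
    | swap h ih => exact ⟨(hC.symm (h.adj hbc)).1 ih.1, ih.2.2, ih.2.1⟩
    | @step u v z h huz hvz ih =>
      obtain ⟨huv, ⟨hau, cau⟩, hav, cav⟩ := ih
      have cuz : C u z := (hC.step (h.adj hbc) huz hvz).1 huv
      have haz : X.Adj a z := by
        by_contra haz
        exact cau ((hC.symm hau).2 ((hC.step hau.symm huz haz).2 cuz))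
      exact ⟨cuz, ⟨hau, cau⟩, haz, fun h' => cav ((hC.step hav haz hvz).2 h')⟩
  obtain ⟨y, hy⟩ := ForcingClass.exists_of_isPrimeGraph hX hbc a
  exact X.loopless.irrefl a (key hy).2.1.1

/-- In a prime graph a forcing-invariant colouring uses only one colour. -/
theorem forall_or_forall_not (hC : X.IsForcingInvariant C) (hX : X.IsPrimeGraph) :
    (∀ u v, X.Adj u v → C u v) ∨ ∀ u v, X.Adj u v → ¬ C u v := by
  by_contra! h
  obtain ⟨⟨b, a, hba, cba⟩, b', c', hb', cb'⟩ := h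
  have key : ∀ {u v}, X.ForcingClass b' c' u v → C u v := by
    intro u v h
    induction h with
    | base => exact cb'
    | swap h ih => exact (hC.symm (h.adj hb')).1 ih
    | step h h₁ h₂ ih => exact (hC.step (h.adj hb') h₁ h₂).1 ih
  -- The two colours meet at `b`, on `b a` and `b c`. So `a c` is an edge, and either colour for it
  -- gives a triangle with one odd edge.
  obtain ⟨c, hc⟩ := ForcingClass.exists_of_isPrimeGraph hX hb' b
  have hbc := hc.adj hb'
  have cbc := key hc
  have hac : X.Adj a c := by
    by_contra hac
    exact cba ((hC.step hba hbc hac).2 cbc)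
  by_cases cac : C a c
  · refine hC.not.not_triangle hX hba hbc.symm hac.symm cba ?_ ?_
    · exact not_not.2 ((hC.symm hbc).1 cbc)
    · exact not_not.2 ((hC.symm hac).1 cac)
  · exact hC.not_triangle hX hbc hba.symm hac cbc (fun h => cba ((hC.symm hba).2 h)) cac

end IsForcingInvariant

theorem IsGraphModule.of_compl {X : SimpleGraph V} {M : Set V} (h : Xᶜ.IsGraphModule M) :
    X.IsGraphModule M := by
  refine ⟨h.1, fun x hx => (h.2 x hx).symm.imp (fun h' m hm => ?_) fun h' m hm => ?_⟩
  · have hne : x ≠ m := fun h => hx (h ▸ hm)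
    have := h' m hm
    rw [compl_adj] at this
    tauto
  · exact (X.compl_adj x m).1 (h' m hm) |>.2

theorem IsPrimeGraph.compl {X : SimpleGraph V} (hX : X.IsPrimeGraph) : Xᶜ.IsPrimeGraph :=
  fun M hM => hX M hM.of_compl

/-- A transitive orientation of a graph. -/
structure IsTransitiveOrientation (X : SimpleGraph V) (P : V → V → Prop) : Prop where
  adj_iff : ∀ u v, X.Adj u v ↔ P u v ∨ P v u
  trans : ∀ u v w, P u v → P v w → P u w

namespace IsTransitiveOrientation

variable {X : SimpleGraph V} {P Q : V → V → Prop}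

theorem asymm (hP : X.IsTransitiveOrientation P) {u v : V} (h : P u v) : ¬ P v u := fun h' =>
  X.loopless.irrefl u ((hP.adj_iff u u).2 (Or.inl (hP.trans _ _ _ h h')))

theorem not_iff (hP : X.IsTransitiveOrientation P) {u v : V} (h : X.Adj u v) :
    ¬ P u v ↔ P v u :=
  ⟨((hP.adj_iff u v).1 h).resolve_left, hP.asymm⟩

/-- If one edge entered `u` and the other left it, transitivity would make `v` and `z` adjacent. -/
theorem iff_of_not_adj (hP : X.IsTransitiveOrientation P) {u v z : V} (huv : X.Adj u v)
    (huz : X.Adj u z) (hvz : ¬ X.Adj v z) : P u v ↔ P u z := by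
  have h₁ := hP.not_iff huv
  have h₂ := hP.not_iff huz
  have h₃ := hP.trans v u z
  have h₄ := hP.trans z u v
  have h₅ := hP.adj_iff v z
  tauto

theorem isForcingInvariant_iff (hP : X.IsTransitiveOrientation P)
    (hQ : X.IsTransitiveOrientation Q) : X.IsForcingInvariant fun u v => (P u v ↔ Q u v) where
  symm {u v} h := by
    have h₁ := hP.not_iff h
    have h₂ := hQ.not_iff h
    tauto
  step h₁ h₂ h₃ := by rw [hP.iff_of_not_adj h₁ h₂ h₃, hQ.iff_of_not_adj h₁ h₂ h₃]

/-- A transitive orientation of a prime graph is unique up to reversal. -/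
theorem eq_or_eq_reverse (hP : X.IsTransitiveOrientation P) (hQ : X.IsTransitiveOrientation Q)
    (hX : X.IsPrimeGraph) : (∀ u v, P u v ↔ Q u v) ∨ ∀ u v, P u v ↔ Q v u := by
  refine ((hP.isForcingInvariant_iff hQ).forall_or_forall_not hX).imp ?_ ?_ <;> intro h u v <;>
    by_cases huv : X.Adj u v
  · exact h u v huv
  · have h₁ := hP.adj_iff u v
    have h₂ := hQ.adj_iff u v
    tauto
  · have h₁ := h u v huv
    have h₂ := hQ.not_iff huv
    tauto
  · have h₁ := hP.adj_iff u v
    have h₂ := hQ.adj_iff u v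
    tauto

theorem comap (hP : X.IsTransitiveOrientation P) (f : X ≃g X) :
    X.IsTransitiveOrientation fun u v => P (f u) (f v) :=
  ⟨fun u v => by rw [← hP.adj_iff, f.map_adj_iff], fun _ _ _ => hP.trans _ _ _⟩

open Classical in
/-- The sign of an automorphism of a prime graph with respect to a transitive orientation: it is
trivial on the automorphisms that preserve the orientation. -/
noncomputable def sign (hP : X.IsTransitiveOrientation P) (hX : X.IsPrimeGraph) :
    (X ≃g X) →* Multiplicative (ZMod 2) where
  toFun f := if ∀ u v, P u v ↔ P (f u) (f v) then 1 else Multiplicative.ofAdd 1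
  map_one' := if_pos fun _ _ => Iff.rfl
  map_mul' f g := by
    have hf := (hP.eq_or_eq_reverse (hP.comap f) hX)
    have hg := (hP.eq_or_eq_reverse (hP.comap g) hX)
    have hmul : ∀ u, (f * g) u = f (g u) := fun _ => rfl
    simp only [hmul]
    by_cases h₁ : ∀ u v, P u v ↔ P (f u) (f v) <;> by_cases h₂ : ∀ u v, P u v ↔ P (g u) (g v)
    · rw [if_pos h₁, if_pos h₂, if_pos fun u v => (h₂ u v).trans (h₁ _ _), one_mul]
    · rw [if_pos h₁, if_neg h₂, if_neg, one_mul]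
      exact fun h => h₂ fun u v => (h u v).trans (h₁ _ _).symm
    · rw [if_neg h₁, if_pos h₂, if_neg, mul_one]
      refine fun h => h₁ fun u v => ?_
      obtain ⟨u, rfl⟩ := g.surjective u
      obtain ⟨v, rfl⟩ := g.surjective v
      exact (h₂ u v).symm.trans (h u v)
    · rw [if_neg h₁, if_neg h₂, if_pos]
      · rfl
      · exact fun u v => (hg.resolve_left h₂ u v).trans (hf.resolve_left h₁ _ _)

theorem iff_of_sign_eq_one (hP : X.IsTransitiveOrientation P) (hX : X.IsPrimeGraph) {f : X ≃g X}
    (h : hP.sign hX f = 1) (u v : V) : P u v ↔ P (f u) (f v) := by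
  by_contra h'
  have : hP.sign hX f = Multiplicative.ofAdd 1 := if_neg fun h'' => h' (h'' u v)
  exact absurd (this.symm.trans h) (by decide)

end IsTransitiveOrientation

/-- The automorphisms of a graph, as automorphisms of its complement. -/
def autCompl (X : SimpleGraph V) : (X ≃g X) →* (Xᶜ ≃g Xᶜ) where
  toFun f := ⟨f.toEquiv, by
    intro u v
    simp only [compl_adj, ne_eq, EmbeddingLike.apply_eq_iff_eq]
    exact and_congr_right' (not_congr f.map_adj_iff)⟩
  map_one' := rfl
  map_mul' _ _ := rfl

/-- Two affine functions meet on `[0, 1]` if and only if their order at `0` is the reverse of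
their order at `1`. -/
theorem exists_affine_eq_iff (a b a' b' : ℝ) :
    (∃ t ∈ Set.Icc (0 : ℝ) 1, a * t + b = a' * t + b') ↔
      (b ≤ b' ∧ a' + b' ≤ a + b) ∨ (b' ≤ b ∧ a + b ≤ a' + b') := by
  constructor
  · rintro ⟨t, ⟨h₀, h₁⟩, ht⟩
    by_contra! h
    -- The difference at `t` is the convex combination of those at `0` and `1`; if these have the
    -- same strict sign, it cannot vanish.
    rcases lt_trichotomy b b' with hb | hb | hb
    · have h' := h.1 hb.le
      rcases h₀.eq_or_lt with rfl | h₀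
      · linarith
      · nlinarith [mul_pos h₀ (sub_pos.2 h'), mul_nonneg (sub_nonneg.2 h₁) (sub_pos.2 hb).le]
    · linarith [h.1 hb.le, h.2 hb.ge]
    · have h' := h.2 hb.le
      rcases h₀.eq_or_lt with rfl | h₀
      · linarith
      · nlinarith [mul_pos h₀ (sub_pos.2 h'), mul_nonneg (sub_nonneg.2 h₁) (sub_pos.2 hb).le]
  · intro h
    have hc : ContinuousOn (fun t : ℝ => (a - a') * t + (b - b')) (Set.uIcc 0 1) := by fun_prop
    have h0 : (0 : ℝ) ∈ (fun t : ℝ => (a - a') * t + (b - b')) '' Set.uIcc 0 1 := by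
      apply intermediate_value_uIcc hc
      rw [Set.mem_uIcc]
      rcases h with h | h
      · exact Or.inl ⟨by linarith, by linarith⟩
      · exact Or.inr ⟨by linarith, by linarith⟩
    obtain ⟨t, ht, h⟩ := h0
    rw [Set.uIcc_of_le zero_le_one] at ht
    exact ⟨t, ht, by dsimp only at h; linarith⟩

/-- A permutation graph and its complement have transitive orientations whose union is a linear
order. -/
theorem IsPermutationGraph.exists_orientations [Finite V] {X : SimpleGraph V}
    (hX : X.IsPermutationGraph) : ∃ (P Q : V → V → Prop) (_ : LinearOrder V),
      X.IsTransitiveOrientation P ∧ Xᶜ.IsTransitiveOrientation Q ∧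
        ∀ u v : V, u < v ↔ P u v ∨ Q u v := by
  obtain ⟨a, b, hab⟩ := hX
  obtain ⟨n, ⟨e⟩⟩ := Finite.exists_equiv_fin V
  simp only [exists_affine_eq_iff] at hab
  -- Ties at `0` are ordered by decreasing value at `1`, so that segments sharing a left end count
  -- as crossing; `e` separates equal functions.
  let key : V → ℝ ×ₗ (ℝ ×ₗ Fin n) := fun v => toLex (b v, toLex (-(a v + b v), e v))
  have hkey : Function.Injective key := fun u v h => e.injective <|
    congrArg (fun x => (ofLex (ofLex x).2).2) h
  have hlt : ∀ u v, key u < key v ↔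
      b u < b v ∨ b u = b v ∧ (a v + b v < a u + b u ∨ a u + b u = a v + b v ∧ e u < e v) := by
    intro u v
    simp only [key, Prod.Lex.toLex_lt_toLex, neg_lt_neg_iff, neg_inj]
  refine ⟨fun u v => key u < key v ∧ a v + b v ≤ a u + b u,
    fun u v => b u < b v ∧ a u + b u < a v + b v, LinearOrder.lift' key hkey,
    ⟨fun u v => ?_, fun u v w h₁ h₂ => ⟨h₁.1.trans h₂.1, h₂.2.trans h₁.2⟩⟩,
    ⟨fun u v => ?_, fun u v w h₁ h₂ => ⟨h₁.1.trans h₂.1, h₁.2.trans h₂.2⟩⟩, fun u v => ?_⟩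
  · have := e.injective.ne_iff (x := u) (y := v)
    rw [hab, hlt, hlt]
    grind
  · have := e.injective.ne_iff (x := u) (y := v)
    rw [compl_adj, hab]
    grind
  · change key u < key v ↔ _
    rw [hlt]
    grind

end SimpleGraph

theorem mainTheorem4 {V : Type*} [Finite V] (X : SimpleGraph V)
    (hprime : X.IsPrimeGraph) (hperm : X.IsPermutationGraph) :
    ∃ H : Subgroup (Multiplicative (ZMod 2 × ZMod 2)), Nonempty ((X ≃g X) ≃* H) := by
  obtain ⟨P, Q, _, hP, hQ, hlt⟩ := hperm.exists_orientations
  let ψ := (hP.sign hprime).prod ((hQ.sign hprime.compl).comp X.autCompl)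
  let e := (MulEquiv.prodMultiplicative (ZMod 2) (ZMod 2)).symm
  have hψ : Function.Injective ψ := by
    refine (injective_iff_map_eq_one ψ).2 fun f hf => ?_
    obtain ⟨h₁, h₂⟩ := Prod.ext_iff.1 hf
    have h₁ := hP.iff_of_sign_eq_one hprime h₁
    have h₂ := hQ.iff_of_sign_eq_one hprime.compl h₂
    have hf : StrictMono f := fun u v h =>
      (hlt _ _).2 (((hlt u v).1 h).imp (h₁ u v).1 (h₂ u v).1)
    -- A finite linear order is a well-order, so it has only one automorphism.
    have key : StrictMono.orderIsoOfSurjective f hf f.surjective = OrderIso.refl V :=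
      Subsingleton.elim _ _
    exact RelIso.ext fun v => congrArg (fun g : V ≃o V => g v) key
  exact ⟨(e.toMonoidHom.comp ψ).range,
    ⟨MonoidHom.ofInjective (f := e.toMonoidHom.comp ψ) (e.injective.comp hψ)⟩⟩
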